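/- Let $q,\lambda>0$ and put $$g_{q,\lambda}(x)=\frac{e^{\lambda x}-qe^{-\lambda x}}{e^{\lambda x}+qe^{-\lambda x}},\qquad M_{q,\lambda}(x)=\tfrac14\bigl(g_{q,\lambda}(x+1)-g_{q,\lambda}(x-1)\bigr),\qquad \Phi(x)=\tfrac12\bigl(M_{q,\lambda}(x)+M_{1/q,\lambda}(x)\bigr).$$ For $n\ge 1$, $h:\mathbb R\to\mathbb R$ and $x\in\mathbb R$ let $$B_n(h,x)=B_n(h)(x)=\sum_{k=-\infty}^{\infty}h\!\left(\tfrac kn\right)\Phi(nx-k).$$ Let $\alpha>0$ with $\alpha\notin\mathbb N$, $N=\lceil\alpha\rceil$, $0<\beta<1$, $0<\varepsilon\le N$ and $x\in\mathbb R$. Let $f\in AC^N(\mathbb R)$, that is, $f:\mathbb R\to\mathbb R$ is of class $C^{N-1}$ and $f^{(N-1)}$ is absolutely continuous on every compact interval, and suppose that $f^{(N)}\in L_\infty(\mathbb R)$. Assume that the Caputo derivatives of order $\alpha$ anchored at $x$, $$D_{*x}^{\alpha}f(t)=\frac1{\Gamma(N-\alpha)}\int_x^t(t-s)^{N-\alpha-1}f^{(N)}(s)\,ds\quad(t\ge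 x),$$ $$D_{x-}^{\alpha}f(t)=\frac{(-1)^N}{\Gamma(N-\alpha)}\int_t^x(s-t)^{N-\alpha-1}f^{(N)}(s)\,ds\quad(t\le x),$$ have finite sup-norms $\|D_{*x}^\alpha f\|_{\infty,[x,\infty)}$ and $\|D_{x-}^\alpha f\|_{\infty,(-\infty,x]}$. If $f^{(N-1)}$ is not differentiable at the point $x$, read $f^{(N)}(x)$ as $0$ below. Then, for every $n\ge 1$, the series defining $B_n(f,x)$ and $B_n((\cdot-x)^j)(x)$, $1\le j\le N$, converge absolutely, and, as $n\to\infty$, $$B_n(f,x)-f(x)=\sum_{j=1}^{N}\frac{f^{(j)}(x)}{j!}\,B_n\bigl((\cdot-x)^j\bigr)(x)+o\!\left(\frac1{n^{\beta(N-\varepsilon)}}\right).$$ Moreover, if $f^{(j)}(x)=0$ for $j=1,\dots,N$, then $$n^{\beta(N-\varepsilon)}\,\bigl[B_n(f,x)-f(x)\bigr]\to0\qquad\text{as }n\to\infty.$$ -/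

import Mathlib

open Filter Topology MeasureTheory Asymptotics
open scoped ENNReal

noncomputable section

/-- The perturbed hyperbolic tangent `g_{q,λ}`. -/
def perturbedTanh (q lam x : ℝ) : ℝ :=
  (Real.exp (lam * x) - q * Real.exp (-(lam * x))) /
    (Real.exp (lam * x) + q * Real.exp (-(lam * x)))

/-- The density `M_{q,λ}(x) = (g_{q,λ}(x+1) - g_{q,λ}(x-1)) / 4`. -/
def tanhDensity (q lam x : ℝ) : ℝ :=
  1 / 4 * (perturbedTanh q lam (x + 1) - perturbedTanh q lam (x - 1))

/-- The symmetrized density `Φ = (M_{q,λ} + M_{1/q,λ}) / 2`. -/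
def symDensity (q lam x : ℝ) : ℝ :=
  (tanhDensity q lam x + tanhDensity (1 / q) lam x) / 2

/-- The `k`-th term `f(k/n) Φ(nx - k)` of the basic neural network operator. -/
def basicTerm (q lam : ℝ) (n : ℕ) (f : ℝ → ℝ) (x : ℝ) (k : ℤ) : ℝ :=
  f ((k : ℝ) / (n : ℝ)) * symDensity q lam ((n : ℝ) * x - (k : ℝ))

/-- The basic neural network operator `B_n(f, x) = ∑_{k ∈ ℤ} f(k/n) Φ(nx - k)`. -/
def basicOp (q lam : ℝ) (n : ℕ) (f : ℝ → ℝ) (x : ℝ) : ℝ :=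
  ∑' k : ℤ, basicTerm q lam n f x k

/-- `f ∈ AC^N(ℝ)` for `N ≥ 1`: `f` is of class `C^{N-1}` and `f^{(N-1)}` is absolutely continuous
on every compact interval. -/
def IsACPow (N : ℕ) (f : ℝ → ℝ) : Prop :=
  ContDiff ℝ ((N - 1 : ℕ) : ℕ∞) f ∧
    ∀ a b : ℝ, AbsolutelyContinuousOnInterval (iteratedDeriv (N - 1) f) a b

/-- The left Caputo derivative `D_{*x}^α f (t)` of non-integer order `α > 0`, anchored at `x`,
for `t ≥ x`; it is extended by zero to `t < x`. -/
def caputoLeft (α : ℝ) (f : ℝ → ℝ) (x t : ℝ) : ℝ :=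
  if x ≤ t then
    1 / Real.Gamma ((⌈α⌉₊ : ℝ) - α) *
      ∫ s in x..t, (t - s) ^ ((⌈α⌉₊ : ℝ) - α - 1) * iteratedDeriv ⌈α⌉₊ f s
  else 0

/-- The right Caputo derivative `D_{x-}^α f (t)` of non-integer order `α > 0`, anchored at `x`,
for `t ≤ x`; it is extended by zero to `t > x`. -/
def caputoRight (α : ℝ) (f : ℝ → ℝ) (x t : ℝ) : ℝ :=
  if t ≤ x then
    (-1) ^ ⌈α⌉₊ / Real.Gamma ((⌈α⌉₊ : ℝ) - α) *
      ∫ s in t..x, (s - t) ^ ((⌈α⌉₊ : ℝ) - α - 1) * iteratedDeriv ⌈α⌉₊ f s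
  else 0

/-- The sup-norm of `g` on `S`, with values in `[0, ∞]`. -/
def supNormOn (S : Set ℝ) (g : ℝ → ℝ) : ℝ≥0∞ :=
  ⨆ t ∈ S, ‖g t‖ₑ

end

/-!
Since `f^{(N-1)}` is absolutely continuous with essentially bounded derivative, it is Lipschitz by
the fundamental theorem of calculus (`exists_lipschitz_of_memLp_top_deriv`), and Taylor's formula
gives
`|f(t) - ∑_{j ≤ N} f^{(j)}(x)/j! (t-x)^j| ≤ C |t-x|^N` on the whole line, whatever value is
assigned to `f^{(N)}(x)` (`exists_abs_sub_taylor_le`). On the other side, `Φ` decays like `e^{-2λ|y|}`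
(`exists_abs_symDensity_le`), so all its discrete absolute moments `∑_k |y-k|^j |Φ(y-k)|` are
bounded uniformly in `y` (`exists_moment_bound`). Rescaling by `n`, a function that is
`O(|t-x|^j)` is sent by `B_n(·, x)` to a quantity of size `O(n^{-j})` (`exists_basicOp_bound`).

The integer translates of `Φ` telescope to a partition of unity (`hasSum_symDensity`), so `B_n`
fixes constants. Hence `B_n(f,x)` minus the expansion is `B_n` of the Taylor remainder, which is
`O(n^{-N})`; this is `o(n^{-β(N-ε)})` because `β(N-ε) < N`.
-/

/-! ### Decay of the density -/

lemma abs_perturbedTanh_sub_one_le {q : ℝ} (hq : 0 < q) (lam x : ℝ) :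
    |perturbedTanh q lam x - 1| ≤ 2 * q * Real.exp (-(2 * (lam * x))) := by
  have h1 := Real.exp_pos (lam * x)
  have h2 := Real.exp_pos (-(lam * x))
  have h3 : Real.exp (lam * x) * Real.exp (-(lam * x)) = 1 := by
    rw [← Real.exp_add]; simp
  have h4 : Real.exp (-(2 * (lam * x))) = Real.exp (-(lam * x)) * Real.exp (-(lam * x)) := by
    rw [← Real.exp_add]; ring_nf
  have h5 : 0 < q * Real.exp (-(lam * x)) := by positivity
  have e : perturbedTanh q lam x - 1 = -(2 * q * Real.exp (-(lam * x)) /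
      (Real.exp (lam * x) + q * Real.exp (-(lam * x)))) := by
    unfold perturbedTanh
    field_simp
    ring
  rw [e, abs_neg, abs_of_pos (by positivity), div_le_iff₀ (by positivity), h4]
  set a := Real.exp (lam * x)
  set b := Real.exp (-(lam * x))
  have : 0 ≤ 2 * q * (b * b) * (q * b) := by positivity
  have h6 : 2 * q * (b * b) * a = 2 * q * b := by
    calc 2 * q * (b * b) * a = 2 * q * b * (a * b) := by ring
      _ = _ := by rw [h3]; ring
  linarith [mul_add (2 * q * (b * b)) a (q * b)]

/-- The reflection `x ↦ -x` exchanges the parameters `q` and `1/q`, up to a sign. -/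
lemma perturbedTanh_neg {q : ℝ} (hq : 0 < q) (lam x : ℝ) :
    perturbedTanh q lam (-x) = -perturbedTanh (1 / q) lam x := by
  have h1 := Real.exp_pos (lam * x)
  have h2 := Real.exp_pos (-(lam * x))
  unfold perturbedTanh
  rw [mul_neg, neg_neg]
  have h5 : 0 < q * Real.exp (lam * x) := by positivity
  have h6 : 0 < 1 / q * Real.exp (-(lam * x)) := by positivity
  rw [← neg_div, div_eq_div_iff (by positivity) (by positivity)]
  field_simp
  ring

lemma abs_perturbedTanh_add_one_le {q : ℝ} (hq : 0 < q) (lam x : ℝ) :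
    |perturbedTanh q lam x + 1| ≤ 2 * (1 / q) * Real.exp (2 * (lam * x)) := by
  have h := abs_perturbedTanh_sub_one_le (one_div_pos.2 hq) lam (-x)
  rw [perturbedTanh_neg (one_div_pos.2 hq), one_div_one_div, ← abs_neg] at h
  convert h using 2
  · ring
  · ring_nf

lemma exists_abs_tanhDensity_le {q lam : ℝ} (hq : 0 < q) (hlam : 0 < lam) :
    ∃ C : ℝ, 0 ≤ C ∧ ∀ y, |tanhDensity q lam y| ≤ C * Real.exp (-(2 * lam) * |y|) := by
  have hq' : 0 < 1 / q := one_div_pos.2 hq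
  refine ⟨(q + 1 / q) * Real.exp (2 * lam), by positivity, fun y => ?_⟩
  -- both values of `g` are compared with the same limit `c = ±1`
  have key : ∀ r c : ℝ, 0 < r → r ≤ q + 1 / q →
      |perturbedTanh q lam (y + 1) - c| ≤ 2 * r * Real.exp (2 * lam + -(2 * lam) * |y|) →
      |perturbedTanh q lam (y - 1) - c| ≤ 2 * r * Real.exp (2 * lam + -(2 * lam) * |y|) →
      |tanhDensity q lam y| ≤
        (q + 1 / q) * Real.exp (2 * lam) * Real.exp (-(2 * lam) * |y|) := by
    intro r c hr hrq h1 h2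
    rw [mul_assoc, ← Real.exp_add]
    refine le_trans ?_ (mul_le_mul_of_nonneg_right hrq (Real.exp_pos _).le)
    unfold tanhDensity
    rw [abs_le] at h1 h2 ⊢
    constructor <;> linarith [h1.1, h1.2, h2.1, h2.2]
  rcases le_total 0 y with hy | hy
  · refine key q 1 hq (by linarith) ?_ ?_
    · refine (abs_perturbedTanh_sub_one_le hq lam _).trans ?_
      rw [abs_of_nonneg hy]
      gcongr
      nlinarith
    · refine (abs_perturbedTanh_sub_one_le hq lam _).trans ?_
      rw [abs_of_nonneg hy]
      gcongr
      nlinarith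
  · refine key (1 / q) (-1) hq' (by linarith) ?_ ?_
    · rw [sub_neg_eq_add]
      refine (abs_perturbedTanh_add_one_le hq lam _).trans ?_
      rw [abs_of_nonpos hy]
      gcongr
      nlinarith
    · rw [sub_neg_eq_add]
      refine (abs_perturbedTanh_add_one_le hq lam _).trans ?_
      rw [abs_of_nonpos hy]
      gcongr
      nlinarith

lemma exists_abs_symDensity_le {q lam : ℝ} (hq : 0 < q) (hlam : 0 < lam) :
    ∃ C : ℝ, 0 ≤ C ∧ ∀ y, |symDensity q lam y| ≤ C * Real.exp (-(2 * lam) * |y|) := by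
  obtain ⟨C, hC, h⟩ := exists_abs_tanhDensity_le hq hlam
  obtain ⟨D, hD, h'⟩ := exists_abs_tanhDensity_le (one_div_pos.2 hq) hlam
  refine ⟨(C + D) / 2, by positivity, fun y => ?_⟩
  have h1 := abs_add_le (tanhDensity q lam y) (tanhDensity (1 / q) lam y)
  unfold symDensity
  rw [abs_div, abs_two]
  linarith [h y, h' y]

/-! ### Uniformly bounded moments -/

lemma summable_abs_int_add_one_pow_mul_exp {c : ℝ} (hc : 0 < c) (j : ℕ) :
    Summable fun i : ℤ => (|(i : ℝ)| + 1) ^ j * Real.exp (-c * |(i : ℝ)|) := by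
  have h : Summable fun n : ℕ => ((n : ℝ) + 1) ^ j * Real.exp (-c * n) := by
    have h0 := (summable_nat_add_iff 1).2 (Real.summable_pow_mul_exp_neg_nat_mul j hc)
    refine (h0.mul_left (Real.exp c)).congr fun n => ?_
    push_cast
    rw [mul_left_comm, ← Real.exp_add]
    ring_nf
  exact Summable.of_nat_of_neg (by simpa using h) (by simpa using h)

/-- The discrete absolute moments of `Φ` are bounded uniformly in the shift `y`; this uniformity is
what makes the constant in `exists_basicOp_bound` independent of `n`. -/
lemma exists_moment_bound {q lam : ℝ} (hq : 0 < q) (hlam : 0 < lam) (j : ℕ) :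
    ∃ K : ℝ, 0 ≤ K ∧ ∀ y : ℝ,
      (Summable fun k : ℤ => |y - k| ^ j * |symDensity q lam (y - k)|) ∧
      ∑' k : ℤ, |y - k| ^ j * |symDensity q lam (y - k)| ≤ K := by
  obtain ⟨C, hC, hΦ⟩ := exists_abs_symDensity_le hq hlam
  set w : ℤ → ℝ := fun i => C * Real.exp (2 * lam) *
    ((|(i : ℝ)| + 1) ^ j * Real.exp (-(2 * lam) * |(i : ℝ)|)) with hw
  have hws : Summable w :=
    (summable_abs_int_add_one_pow_mul_exp (by positivity : 0 < 2 * lam) j).mul_left _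
  have hw0 : ∀ i, 0 ≤ w i := fun i => by positivity
  refine ⟨∑' i, w i, tsum_nonneg hw0, fun y => ?_⟩
  -- shifting the index by `⌊y⌋` gives a majorant independent of `y`
  have hshift : Summable fun k : ℤ => w (k - ⌊y⌋) :=
    (Equiv.subRight ⌊y⌋).summable_iff.2 hws
  have hle : ∀ k : ℤ, |y - k| ^ j * |symDensity q lam (y - k)| ≤ w (k - ⌊y⌋) := by
    intro k
    have hfl := Int.floor_le y
    have hfl' := (Int.lt_floor_add_one y).le
    have hd : |y - ⌊y⌋| ≤ 1 := by rw [abs_le]; constructor <;> linarith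
    have h1 : |y - k| ≤ |((k - ⌊y⌋ : ℤ) : ℝ)| + 1 := by
      push_cast
      have := abs_sub_le y (⌊y⌋ : ℝ) k
      rw [abs_sub_comm (⌊y⌋ : ℝ)] at this
      linarith
    have h2 : |((k - ⌊y⌋ : ℤ) : ℝ)| ≤ |y - k| + 1 := by
      push_cast
      have := abs_sub_le (k : ℝ) y ⌊y⌋
      rw [abs_sub_comm (k : ℝ) y] at this
      linarith
    have h3 : Real.exp (-(2 * lam) * |y - k|) ≤
        Real.exp (2 * lam) * Real.exp (-(2 * lam) * |((k - ⌊y⌋ : ℤ) : ℝ)|) := by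
      rw [← Real.exp_add]
      apply Real.exp_le_exp.2
      nlinarith
    calc |y - k| ^ j * |symDensity q lam (y - k)|
        ≤ (|((k - ⌊y⌋ : ℤ) : ℝ)| + 1) ^ j *
          (C * (Real.exp (2 * lam) * Real.exp (-(2 * lam) * |((k - ⌊y⌋ : ℤ) : ℝ)|))) := by
          gcongr
          exact (hΦ _).trans (by gcongr)
      _ = w (k - ⌊y⌋) := by rw [hw]; ring
  have hs : Summable fun k : ℤ => |y - k| ^ j * |symDensity q lam (y - k)| :=
    Summable.of_nonneg_of_le (fun k => by positivity) hle hshift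
  refine ⟨hs, (hs.tsum_le_tsum hle hshift).trans_eq ?_⟩
  exact (Equiv.subRight ⌊y⌋).tsum_eq w

/-- A function that is `O(|t - x|^j)` on the line is sent to a quantity `O(n^{-j})`, since
`|k/n - x| = |nx - k| / n`. -/
lemma exists_basicOp_bound {q lam : ℝ} (hq : 0 < q) (hlam : 0 < lam) (j : ℕ) :
    ∃ K : ℝ, 0 ≤ K ∧ ∀ (h : ℝ → ℝ) (x C : ℝ), (∀ t, |h t| ≤ C * |t - x| ^ j) →
      ∀ n : ℕ, 1 ≤ n → Summable (basicTerm q lam n h x) ∧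
        |basicOp q lam n h x| ≤ C * K / (n : ℝ) ^ j := by
  obtain ⟨K, hK, hmom⟩ := exists_moment_bound hq hlam j
  refine ⟨K, hK, fun h x C hh n hn => ?_⟩
  have hn' : (0 : ℝ) < n := by exact_mod_cast hn
  have hC : 0 ≤ C := by
    have := (abs_nonneg _).trans (hh (x + 1))
    simpa using this
  obtain ⟨hs, hle⟩ := hmom (n * x)
  have hterm : ∀ k : ℤ, ‖basicTerm q lam n h x k‖ ≤
      C / (n : ℝ) ^ j * (|n * x - k| ^ j * |symDensity q lam (n * x - k)|) := by
    intro k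
    have e : |(k : ℝ) / n - x| = |n * x - k| / n := by
      rw [← abs_of_pos hn', ← abs_div, abs_of_pos hn', abs_sub_comm]
      congr 1
      field_simp
    rw [basicTerm, Real.norm_eq_abs, abs_mul]
    calc _ ≤ C * |(k : ℝ) / n - x| ^ j * |symDensity q lam (n * x - k)| := by
          gcongr; exact hh _
      _ = _ := by rw [e, div_pow]; ring
  have hs' := hs.mul_left (C / (n : ℝ) ^ j)
  refine ⟨Summable.of_norm_bounded hs' hterm, ?_⟩
  refine (tsum_of_norm_bounded hs'.hasSum hterm).trans ?_
  rw [tsum_mul_left, mul_div_right_comm]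
  gcongr

/-! ### Partition of unity -/

lemma tendsto_perturbedTanh_atTop {q lam : ℝ} (hq : 0 < q) (hlam : 0 < lam) :
    Tendsto (perturbedTanh q lam) atTop (𝓝 1) := by
  rw [← tendsto_sub_nhds_zero_iff]
  refine squeeze_zero_norm (fun x => abs_perturbedTanh_sub_one_le hq lam x) ?_
  rw [show (0 : ℝ) = 2 * q * 0 by simp]
  refine Tendsto.const_mul _ (Real.tendsto_exp_neg_atTop_nhds_zero.comp ?_)
  exact (tendsto_id.const_mul_atTop hlam).const_mul_atTop two_pos

lemma tendsto_perturbedTanh_atBot {q lam : ℝ} (hq : 0 < q) (hlam : 0 < lam) :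
    Tendsto (perturbedTanh q lam) atBot (𝓝 (-1)) := by
  have h := ((tendsto_perturbedTanh_atTop (one_div_pos.2 hq) hlam).comp
    tendsto_neg_atBot_atTop).neg
  refine h.congr fun x => ?_
  simp only [Function.comp_apply]
  rw [perturbedTanh_neg (one_div_pos.2 hq), one_div_one_div, neg_neg]

/-- Telescoping sums over `ℤ`. -/
lemma hasSum_int_sub_of_tendsto {H : ℤ → ℝ} {a b : ℝ}
    (hs : Summable fun k : ℤ => H k - H (k + 1))
    (ha : Tendsto (fun n : ℕ => H n) atTop (𝓝 a))
    (hb : Tendsto (fun n : ℕ => H (-n)) atTop (𝓝 b)) :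
    HasSum (fun k : ℤ => H k - H (k + 1)) (b - a) := by
  have hs1 : Summable fun n : ℕ => H n - H ((n : ℤ) + 1) :=
    hs.comp_injective (i := fun n : ℕ => (n : ℤ)) Nat.cast_injective
  have hs2 : Summable fun n : ℕ => H (-((n : ℤ) + 1)) - H (-((n : ℤ) + 1) + 1) :=
    hs.comp_injective (i := fun n : ℕ => -((n : ℤ) + 1)) fun m n h => by simpa using h
  have h1 : HasSum (fun n : ℕ => H n - H ((n : ℤ) + 1)) (H 0 - a) := by
    rw [hs1.hasSum_iff_tendsto_nat]
    refine (tendsto_const_nhds.sub ha).congr fun n => ?_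
    have := Finset.sum_range_sub' (fun n : ℕ => H n) n
    simpa using this.symm
  have h2 : HasSum (fun n : ℕ => H (-((n : ℤ) + 1)) - H (-((n : ℤ) + 1) + 1)) (b - H 0) := by
    rw [hs2.hasSum_iff_tendsto_nat]
    refine (hb.sub tendsto_const_nhds).congr fun n => ?_
    have := Finset.sum_range_sub (fun n : ℕ => H (-n)) n
    simpa using this.symm
  have := HasSum.of_nat_of_neg_add_one (f := fun k : ℤ => H k - H (k + 1)) h1 h2
  convert this using 1
  ring

lemma hasSum_tanhDensity {q lam : ℝ} (hq : 0 < q) (hlam : 0 < lam) (y : ℝ) :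
    HasSum (fun k : ℤ => tanhDensity q lam (y - k)) 1 := by
  -- `g(z + 1) - g(z - 1)` is a difference of step one of `g(z) + g(z + 1)`
  set H : ℤ → ℝ := fun k =>
    (perturbedTanh q lam (y - k) + perturbedTanh q lam (y - k + 1)) / 4 with hH
  have e : (fun k : ℤ => tanhDensity q lam (y - k)) = fun k => H k - H (k + 1) := by
    funext k
    simp only [hH, tanhDensity]
    push_cast
    rw [show y - ((k : ℝ) + 1) + 1 = y - k by ring, show y - ((k : ℝ) + 1) = y - k - 1 by ring]
    ring
  have hs : Summable fun k : ℤ => tanhDensity q lam (y - k) := by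
    obtain ⟨C, hC, hM⟩ := exists_abs_tanhDensity_le hq hlam
    have hw := summable_abs_int_add_one_pow_mul_exp (by positivity : 0 < 2 * lam) 0
    refine Summable.of_norm_bounded (hw.mul_left (C * Real.exp (2 * lam * |y|))) fun k => ?_
    refine (hM _).trans ?_
    rw [pow_zero, one_mul, mul_assoc, ← Real.exp_add]
    gcongr
    have := abs_sub_abs_le_abs_sub (k : ℝ) y
    rw [abs_sub_comm] at this
    nlinarith
  rw [e] at hs ⊢
  have hbot : Tendsto (fun n : ℕ => y - (n : ℝ)) atTop atBot :=
    tendsto_atBot_add_const_left _ y (tendsto_neg_atTop_atBot.comp tendsto_natCast_atTop_atTop)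
  have htop : Tendsto (fun n : ℕ => y + (n : ℝ)) atTop atTop :=
    tendsto_atTop_add_const_left _ y tendsto_natCast_atTop_atTop
  have hbot' := tendsto_atBot_add_const_right _ (1 : ℝ) hbot
  have htop' := tendsto_atTop_add_const_right _ (1 : ℝ) htop
  have gb := tendsto_perturbedTanh_atBot hq hlam
  have gt := tendsto_perturbedTanh_atTop hq hlam
  have ha : Tendsto (fun n : ℕ => H n) atTop (𝓝 ((-1 + -1) / 4)) := by
    simpa [hH, Function.comp_def] using ((gb.comp hbot).add (gb.comp hbot')).div_const 4
  have hb : Tendsto (fun n : ℕ => H (-n)) atTop (𝓝 ((1 + 1) / 4)) := by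
    simpa [hH, Function.comp_def] using ((gt.comp htop).add (gt.comp htop')).div_const 4
  have := hasSum_int_sub_of_tendsto hs ha hb
  norm_num at this
  exact this

lemma hasSum_symDensity {q lam : ℝ} (hq : 0 < q) (hlam : 0 < lam) (y : ℝ) :
    HasSum (fun k : ℤ => symDensity q lam (y - k)) 1 := by
  have := ((hasSum_tanhDensity hq hlam y).add
    (hasSum_tanhDensity (one_div_pos.2 hq) hlam y)).div_const 2
  norm_num at this
  simpa [symDensity] using this

lemma hasSum_basicTerm_const {q lam : ℝ} (hq : 0 < q) (hlam : 0 < lam) (n : ℕ) (c x : ℝ) :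
    HasSum (basicTerm q lam n (fun _ => c) x) c := by
  have h := (hasSum_symDensity hq hlam (n * x)).mul_left c
  rw [mul_one] at h
  exact h

/-! ### Taylor's formula with bounded last derivative -/

/-- A uniform bound of the remainder from a Lipschitz condition, at the base point only, on the
last derivative. -/
lemma abs_sub_taylor_le_of_lipschitz_at {L x : ℝ} (hL : 0 ≤ L) (n : ℕ) {f : ℝ → ℝ}
    (hf : ContDiff ℝ n f)
    (hlip : ∀ t, |iteratedDeriv n f t - iteratedDeriv n f x| ≤ L * |t - x|) (t : ℝ) :
    |f t - ∑ j ∈ Finset.range (n + 1), iteratedDeriv j f x / (j.factorial : ℝ) * (t - x) ^ j| ≤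
      L * |t - x| ^ (n + 1) := by
  induction n generalizing f t with
  | zero => simpa using hlip t
  | succ n ih =>
    have hf' : ContDiff ℝ n (deriv f) := by
      have : ContDiff ℝ ((n : WithTop ℕ∞) + 1) f := by exact_mod_cast hf
      exact (contDiff_succ_iff_deriv.1 this).2.2
    have hd : Differentiable ℝ f := hf.differentiable (by simp)
    have ih' := ih hf' (by simpa only [iteratedDeriv_succ'] using hlip)
    set P : ℝ → ℝ := fun t => ∑ j ∈ Finset.range (n + 2),
      iteratedDeriv j f x / (j.factorial : ℝ) * (t - x) ^ j with hP
    -- the derivative of the Taylor polynomial of `f` is the Taylor polynomial of `f'`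
    have hPd : ∀ s, HasDerivAt P (∑ j ∈ Finset.range (n + 1),
        iteratedDeriv j (deriv f) x / (j.factorial : ℝ) * (s - x) ^ j) s := by
      intro s
      have h1 : HasDerivAt P (∑ j ∈ Finset.range (n + 2),
          iteratedDeriv j f x / (j.factorial : ℝ) * (j * (s - x) ^ (j - 1) * 1)) s :=
        HasDerivAt.fun_sum fun j _ =>
          ((((hasDerivAt_id s).sub_const x).pow j).const_mul _)
      convert h1 using 1
      rw [Finset.sum_range_succ' _ (n + 1)]
      simp only [Nat.cast_zero, zero_mul, mul_zero, add_zero]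
      refine Finset.sum_congr rfl fun j _ => ?_
      rw [iteratedDeriv_succ', Nat.factorial_succ]
      push_cast
      have : (j : ℝ) + 1 ≠ 0 := by positivity
      have : (j.factorial : ℝ) ≠ 0 := by positivity
      field_simp
    have hPx : P x = f x := by
      simp only [hP, sub_self]
      rw [Finset.sum_range_succ']
      simp
    have hmv := (convex_uIcc x t).norm_image_sub_le_of_norm_hasDerivWithin_le
      (f := fun s => f s - P s) (C := L * |t - x| ^ (n + 1)) (x := x) (y := t)
      (fun s _ => ((hd s).hasDerivAt.sub (hPd s)).hasDerivWithinAt)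
      (fun s hs => (ih' s).trans (by
        have := Set.abs_sub_left_of_mem_uIcc hs
        gcongr)) Set.left_mem_uIcc Set.right_mem_uIcc
    rw [hPx, sub_self, sub_zero, Real.norm_eq_abs, Real.norm_eq_abs] at hmv
    rw [pow_succ, ← mul_assoc]
    exact hmv

lemma exists_lipschitz_of_memLp_top_deriv {g : ℝ → ℝ}
    (hac : ∀ a b, AbsolutelyContinuousOnInterval g a b) (hg : MemLp (deriv g) ∞ volume) :
    ∃ L : ℝ, 0 ≤ L ∧ ∀ s t, |g t - g s| ≤ L * |t - s| := by
  refine ⟨(eLpNormEssSup (deriv g) volume).toReal, ENNReal.toReal_nonneg, fun s t => ?_⟩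
  have hfin : eLpNormEssSup (deriv g) volume ≠ ∞ := by
    have := hg.eLpNorm_lt_top
    rw [eLpNorm_exponent_top] at this
    exact this.ne
  rw [← (hac s t).integral_deriv_eq_sub]
  refine intervalIntegral.norm_integral_le_of_norm_le_const_ae (f := deriv g) ?_
  filter_upwards [enorm_ae_le_eLpNormEssSup (deriv g) volume] with u hu _
  rw [← toReal_enorm]
  exact ENNReal.toReal_mono hfin hu

/-- The sum runs up to the order `N`, at which `f` need not be differentiable at `x`: the last term
is only required to be of the size of the remainder, so a junk value `0` of `f^{(N)}(x)` does no
harm. -/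
lemma exists_abs_sub_taylor_le {N : ℕ} (hN : 1 ≤ N) {f : ℝ → ℝ} (hf : IsACPow N f)
    (hfN : MemLp (iteratedDeriv N f) ∞ volume) (x : ℝ) :
    ∃ C : ℝ, ∀ t, |f t - f x - ∑ j ∈ Finset.Icc 1 N,
      iteratedDeriv j f x / (j.factorial : ℝ) * (t - x) ^ j| ≤ C * |t - x| ^ N := by
  obtain ⟨n, rfl⟩ : ∃ n, N = n + 1 := ⟨N - 1, by omega⟩
  obtain ⟨hcd, hac⟩ := hf
  simp only [Nat.add_sub_cancel] at hcd hac
  rw [iteratedDeriv_succ] at hfN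
  obtain ⟨L, hL, hlip⟩ := exists_lipschitz_of_memLp_top_deriv hac hfN
  -- the term of order `N` is itself of the size of the remainder
  set c := iteratedDeriv (n + 1) f x / ((n + 1).factorial : ℝ) with hc
  refine ⟨L + |c|, fun t => ?_⟩
  have h := abs_sub_taylor_le_of_lipschitz_at hL n (by exact_mod_cast hcd) (hlip x) t
  have e : f t - f x - ∑ j ∈ Finset.Icc 1 (n + 1),
      iteratedDeriv j f x / (j.factorial : ℝ) * (t - x) ^ j =
      (f t - ∑ j ∈ Finset.range (n + 1), iteratedDeriv j f x / (j.factorial : ℝ) * (t - x) ^ j)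
        - c * (t - x) ^ (n + 1) := by
    have h2 : ∑ j ∈ Finset.range (n + 2), iteratedDeriv j f x / (j.factorial : ℝ) * (t - x) ^ j =
        f x + ∑ j ∈ Finset.Icc 1 (n + 1),
          iteratedDeriv j f x / (j.factorial : ℝ) * (t - x) ^ j := by
      rw [Finset.range_eq_Ico, Finset.sum_eq_sum_Ico_succ_bot (by omega)]
      simp only [iteratedDeriv_zero, Nat.factorial_zero, pow_zero]
      congr 1
      simp
    rw [Finset.sum_range_succ, ← hc] at h2
    linarith
  rw [e]
  refine (abs_sub _ _).trans ?_
  rw [abs_mul, abs_pow, add_mul]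
  gcongr

/-! ### The expansion -/

/-- Linearity of the operator, on a constant plus a finite combination plus a remainder. -/
lemma hasSum_basicTerm_of_decomp {q lam : ℝ} (hq : 0 < q) (hlam : 0 < lam) (n : ℕ) {x c : ℝ}
    {f r : ℝ → ℝ} (s : Finset ℕ) (a : ℕ → ℝ) (p : ℕ → ℝ → ℝ)
    (hfr : ∀ t, f t = c + ∑ j ∈ s, a j * p j t + r t)
    (hp : ∀ j ∈ s, Summable (basicTerm q lam n (p j) x))
    (hr : Summable (basicTerm q lam n r x)) :
    HasSum (basicTerm q lam n f x)
      (c + ∑ j ∈ s, a j * basicOp q lam n (p j) x + basicOp q lam n r x) := by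
  have h := ((hasSum_basicTerm_const hq hlam n c x).add
    (hasSum_sum fun j hj => (hp j hj).hasSum.mul_left (a j))).add hr.hasSum
  refine h.congr_fun ?_
  intro k
  simp only [basicTerm, hfr, add_mul, Finset.sum_mul, mul_assoc]

theorem mainTheorem4
    (q lam : ℝ) (hq : 0 < q) (hlam : 0 < lam)
    (α : ℝ) (hα : 0 < α) (hαnat : ∀ m : ℕ, α ≠ (m : ℝ))
    (N : ℕ) (hN : N = ⌈α⌉₊)
    (f : ℝ → ℝ) (hf : IsACPow N f) (hfN : MemLp (iteratedDeriv N f) ∞ volume)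
    (β : ℝ) (hβ0 : 0 < β) (hβ1 : β < 1)
    (ε : ℝ) (hε0 : 0 < ε) (hεN : ε ≤ (N : ℝ))
    (x : ℝ)
    (hleft : supNormOn (Set.Ici x) (caputoLeft α f x) < ∞)
    (hright : supNormOn (Set.Iic x) (caputoRight α f x) < ∞) :
    -- the series defining the operators converge (absolutely)
    (∀ n : ℕ, 1 ≤ n →
      Summable (basicTerm q lam n f x) ∧
      ∀ j ∈ Finset.Icc 1 N, Summable (basicTerm q lam n (fun t => (t - x) ^ j) x)) ∧
    -- the expansion
    ((fun n : ℕ => basicOp q lam n f x - f x -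
        ∑ j ∈ Finset.Icc 1 N, iteratedDeriv j f x / (j.factorial : ℝ) *
          basicOp q lam n (fun t => (t - x) ^ j) x)
      =o[atTop] fun n : ℕ => 1 / (n : ℝ) ^ (β * ((N : ℝ) - ε))) ∧
    -- the case of vanishing derivatives
    ((∀ j ∈ Finset.Icc 1 N, iteratedDeriv j f x = 0) →
      Tendsto (fun n : ℕ => (n : ℝ) ^ (β * ((N : ℝ) - ε)) * (basicOp q lam n f x - f x))
        atTop (𝓝 0)) := by
  have hN1 : 1 ≤ N := by
    rw [hN]; exact Nat.ceil_pos.2 hα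
  set r : ℝ → ℝ := fun t => f t - f x - ∑ j ∈ Finset.Icc 1 N,
    iteratedDeriv j f x / (j.factorial : ℝ) * (t - x) ^ j with hr
  obtain ⟨C, hC⟩ := exists_abs_sub_taylor_le hN1 hf hfN x
  obtain ⟨K, -, hK⟩ := exists_basicOp_bound hq hlam N
  have hrem := hK r x C hC
  have hpow : ∀ n : ℕ, 1 ≤ n → ∀ j, Summable (basicTerm q lam n (fun t => (t - x) ^ j) x) := by
    intro n hn j
    obtain ⟨K', -, hK'⟩ := exists_basicOp_bound hq hlam j
    exact (hK' _ x 1 (fun t => by rw [abs_pow, one_mul]) n hn).1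
  have hsum := fun (n : ℕ) (hn : 1 ≤ n) =>
    hasSum_basicTerm_of_decomp hq hlam n (x := x) (c := f x) (f := f) (r := r) (Finset.Icc 1 N)
      (fun j => iteratedDeriv j f x / (j.factorial : ℝ)) (fun j t => (t - x) ^ j)
      (fun t => by simp only [hr]; ring) (fun j _ => hpow n hn j) (hrem n hn).1
  have hexp : (fun n : ℕ => basicOp q lam n f x - f x -
        ∑ j ∈ Finset.Icc 1 N, iteratedDeriv j f x / (j.factorial : ℝ) *
          basicOp q lam n (fun t => (t - x) ^ j) x)
      =o[atTop] fun n : ℕ => 1 / (n : ℝ) ^ (β * ((N : ℝ) - ε)) := by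
    have hbig : (fun n : ℕ => basicOp q lam n f x - f x -
        ∑ j ∈ Finset.Icc 1 N, iteratedDeriv j f x / (j.factorial : ℝ) *
          basicOp q lam n (fun t => (t - x) ^ j) x)
        =O[atTop] fun n : ℕ => (n : ℝ) ^ (-(N : ℝ)) := by
      refine IsBigO.of_bound (C * K) ?_
      filter_upwards [eventually_ge_atTop 1] with n hn
      have hop : basicOp q lam n f x = _ := (hsum n hn).tsum_eq
      rw [hop, Real.norm_eq_abs,
        Real.norm_of_nonneg (by positivity : 0 ≤ (n : ℝ) ^ (-(N : ℝ))), Real.rpow_neg (by positivity), Real.rpow_natCast, ← div_eq_mul_inv]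
      refine le_trans (le_of_eq ?_) (hrem n hn).2
      congr 1
      ring
    have hgap : 0 < N - β * ((N : ℝ) - ε) := by nlinarith
    have hlittle : (fun n : ℕ => (n : ℝ) ^ (-(N : ℝ)))
        =o[atTop] fun n : ℕ => 1 / (n : ℝ) ^ (β * ((N : ℝ) - ε)) := by
      refine isLittleO_of_tendsto' ?_ (((tendsto_rpow_neg_atTop hgap).comp
        tendsto_natCast_atTop_atTop).congr' ?_)
      · filter_upwards [eventually_ge_atTop 1] with n hn h0
        have : (0 : ℝ) < n := by exact_mod_cast hn
        exact absurd h0 (by positivity)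
      · filter_upwards [eventually_ge_atTop 1] with n hn
        have : (0 : ℝ) < n := by exact_mod_cast hn
        rw [Function.comp_apply, div_div_eq_mul_div, div_one, ← Real.rpow_add this]
        ring_nf
    exact hbig.trans_isLittleO hlittle
  refine ⟨fun n hn => ⟨(hsum n hn).summable, fun j _ => hpow n hn j⟩, hexp, fun hz => ?_⟩
  have hexp' : (fun n : ℕ => basicOp q lam n f x - f x)
      =o[atTop] fun n : ℕ => 1 / (n : ℝ) ^ (β * ((N : ℝ) - ε)) := by
    refine hexp.congr_left fun n => ?_
    rw [Finset.sum_eq_zero fun j hj => by rw [hz j hj]; simp, sub_zero]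
  refine hexp'.tendsto_div_nhds_zero.congr fun n => ?_
  rw [div_div_eq_mul_div, div_one, mul_comm]
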